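/- Let $G$ be a finite connected simple graph embedded in the plane (each undirected edge $\{u,v\}$ also being viewed as the two oriented edges $(u,v)$ and $(v,u)$), and let $\partial R$ be a simple cycle of $G$, the boundary of the single hole of a region $R$. Let $R^{\mathrm{out}}$ be the subgraph of $G$ consisting of $\partial R$ together with everything that lies on one fixed side of it (the side away from $R$). The faces of $R^{\mathrm{out}}$ other than the hole bounded by $\partial R$ are then the faces of $G$ on that side. A *chord* of $R^{\mathrm{out}}$ is an oriented simple path in $R^{\mathrm{out}}$ whose two endpoints lie on $\partial R$ and none of whose interior vertices lies on $\partial R$. A set $\mathcal{C}$ of chords is *laminar* (non-crossing) if, for any two chords $C, C' \in \mathcal{C}$ and any vertex $v \in C \cap C'$ not on $\partial R$, the subpath of $C$ from its starting point to $v$ and the subpath of $C'$ from its starting point to $v$ are identical. Given a laminar chord set $\mathcal{C}$, two faces of $R^{\mathrm{out}}$ other than the hole are in the same *piece* if and only if they are joined by a path in the dual graph $(R^{\mathrm{out}})^*$ that avoids the duals of all edges of chords in $\mathcal{C}$ and of all edges of $\partial R$. A piece contains the edges incident to its faces. Two distinct pieces are *adjacent* if some edge belongs to both of them and this edge, with one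 of its two orientations, is traversed by exactly one chord of $\mathcal{C}$. Let $\mathcal{P}$ be the set of pieces and $\mathcal{E}$ the set of pairs of adjacent pieces. Then $\mathcal{T} = (\mathcal{P}, \mathcal{E})$ is a tree (called the *piece tree* induced by $\mathcal{C}$). -/

import Mathlib

/-- A combinatorial embedding of a graph: the clockwise cyclic order of the darts (oriented edges)
leaving each vertex, given as one permutation of all darts whose orbits are the sets of darts with
a common origin. -/
structure RotationSystem {V : Type*} (G : SimpleGraph V) where
  /-- the clockwise successor of a dart around its origin -/
  next : Equiv.Perm G.Dart
  next_fst : ∀ d, (next d).fst = d.fst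
  sameCycle_of_fst_eq : ∀ d d' : G.Dart, d.fst = d'.fst → next.SameCycle d d'

namespace RotationSystem

variable {V : Type*} {G : SimpleGraph V} (ρ : RotationSystem G)

/-- The successor of a dart on the boundary of the face to its left: having traversed `(u, v)`,
continue with the dart that follows `(v, u)` clockwise around `v`. -/
def faceNext : Equiv.Perm G.Dart :=
  (SimpleGraph.Dart.symm_involutive (G := G)).toPerm.trans ρ.next

/-- The faces: orbits of the face permutation. -/
def Face : Type _ := Quotient (Equiv.Perm.SameCycle.setoid ρ.faceNext)

/-- The face to the left of a dart. The face to its right is `ρ.leftFace d.symm`. -/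
def leftFace (d : G.Dart) : ρ.Face := Quotient.mk (Equiv.Perm.SameCycle.setoid ρ.faceNext) d

/-- The embedding of a connected graph is planar: Euler's formula `|V| - |E| + |F| = 2`. -/
def IsPlanar : Prop :=
  Nat.card V + Nat.card ρ.Face = Nat.card G.edgeSet + 2

/-- The dual graph with the duals of the edges in `S` deleted (loops and multiplicities are
forgotten). -/
def dualAvoiding (S : Set (Sym2 V)) : SimpleGraph ρ.Face where
  Adj f g := f ≠ g ∧ ∃ d : G.Dart, d.edge ∉ S ∧ ρ.leftFace d = f ∧ ρ.leftFace d.symm = g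
  symm := ⟨by
    rintro f g ⟨hne, d, hd, rfl, rfl⟩
    exact ⟨hne.symm, d.symm, by simpa using hd, rfl, by simp⟩⟩
  loopless := ⟨fun _ h => h.1 rfl⟩

variable {r : V} (B : G.Walk r r)

/-- For a simple cycle `B` (the boundary cycle `∂R`), oriented so that `R^out` lies to its left:
the faces of `R^out` other than the hole bounded by `B`, i.e. the faces of the embedded graph on
the left side of `B`. -/
def IsOutFace (f : ρ.Face) : Prop :=
  ∃ d ∈ B.darts, (ρ.dualAvoiding {e | e ∈ B.edges}).Reachable (ρ.leftFace d) f

/-- The dart `d` belongs to `R^out`: its edge is incident to a face on the left side of `B`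
(this includes the edges of `B` itself). -/
def IsOutDart (d : G.Dart) : Prop :=
  ρ.IsOutFace B (ρ.leftFace d) ∨ ρ.IsOutFace B (ρ.leftFace d.symm)

end RotationSystem

/-- An oriented simple path. -/
structure OrientedPath {V : Type*} (G : SimpleGraph V) where
  source : V
  target : V
  walk : G.Walk source target
  isPath : walk.IsPath

namespace RotationSystem

variable {V : Type*} {G : SimpleGraph V} (ρ : RotationSystem G) {r : V} (B : G.Walk r r)

/-- `X` is a chord of `R^out`: an oriented simple path in `R^out` joining vertices of the boundary
cycle `B` and with no interior vertex on `B`. -/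
structure IsChord (X : OrientedPath G) : Prop where
  source_mem : X.source ∈ B.support
  target_mem : X.target ∈ B.support
  isOutDart : ∀ d ∈ X.walk.darts, ρ.IsOutDart B d
  interior : ∀ v ∈ X.walk.support, v ∈ B.support → v = X.source ∨ v = X.target

/-- A laminar set of chords: whenever two of them share a vertex `v` off the boundary cycle, their
initial subpaths up to `v` coincide. -/
structure IsLaminarChordSet [DecidableEq V] (𝒞 : Set (OrientedPath G)) : Prop where
  isChord : ∀ X ∈ 𝒞, ρ.IsChord B X
  laminar : ∀ X ∈ 𝒞, ∀ Y ∈ 𝒞, ∀ v, ∀ (hX : v ∈ X.walk.support) (hY : v ∈ Y.walk.support),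
    v ∉ B.support → (X.walk.takeUntil v hX).support = (Y.walk.takeUntil v hY).support

/-- The edges of the boundary cycle and of the chords. -/
def cutEdges (𝒞 : Set (OrientedPath G)) : Set (Sym2 V) :=
  {e | e ∈ B.edges ∨ ∃ X ∈ 𝒞, e ∈ X.walk.edges}

/-- The pieces: classes of non-hole faces of `R^out` under the relation of being joined by a path
in the dual that avoids the duals of the chord edges and of the boundary edges. -/
def Piece (𝒞 : Set (OrientedPath G)) : Type _ :=
  ((ρ.dualAvoiding (cutEdges B 𝒞)).induce {f | ρ.IsOutFace B f}).ConnectedComponent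

variable {ρ B}

/-- The edge of `d` belongs to the piece `P`: it is incident to a face of `P`. -/
def Piece.HasEdge {𝒞 : Set (OrientedPath G)} (P : ρ.Piece B 𝒞) (d : G.Dart) : Prop :=
  ∃ f : {f | ρ.IsOutFace B f},
    SimpleGraph.connectedComponentMk _ f = P ∧ (ρ.leftFace d = f ∨ ρ.leftFace d.symm = f)

variable (ρ B)

/-- The piece adjacency graph: two distinct pieces are adjacent if they share an edge which
(as an oriented edge) lies on a unique chord of `𝒞`. -/
def pieceGraph (𝒞 : Set (OrientedPath G)) : SimpleGraph (ρ.Piece B 𝒞) where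
  Adj P Q := P ≠ Q ∧ ∃ d : G.Dart, P.HasEdge d ∧ Q.HasEdge d ∧ ∃! X, X ∈ 𝒞 ∧ d ∈ X.walk.darts
  symm := ⟨by
    rintro P Q ⟨hne, d, hP, hQ, h⟩
    exact ⟨hne.symm, d, hQ, hP, h⟩⟩
  loopless := ⟨fun _ h => h.1 rfl⟩

end RotationSystem

/-! Laminar chords that meet off `B` share a stem from their common source and branch only forwards,
so the last edge of a chord is on no other chord in that direction. Connectedness: fix a piece `P`
and call a face good if its piece is reachable from `P`. The faces on the left of `B` are joined in
the dual without crossing `B`, so it suffices that goodness survives crossing any edge off `B`. Only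
chord edges matter, and these are treated from the end of the chord backwards. Across a last edge
the two pieces are equal or adjacent. Across an earlier edge, turn around its head from one side to
the other: every chord edge crossed lies further along some chord
(`IsLaminarChordSet.reachable_iff_of_getVert`). Acyclicity: every adjacency is a bridge. Let it come
from an edge used only by the chord `X`. Closing `X` up along `B` gives a cycle modulo 2, which by
planarity is the jump set of a function `φ` on faces (`IsPlanar.exists_faceCoboundary_eq`). Off `B`,
`φ` jumps exactly across `X`, so it is constant on pieces and differs at the two ends of the
adjacency. No other adjacency changes `φ`: once an edge of `X` is private, so are all later ones,
with the same two pieces beside them (`IsLaminarChordSet.sides_eq`). -/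

namespace RotationSystem

/-! ### Turning around a vertex, and connectedness of the dual -/

section Rotation

variable {V : Type*} {G : SimpleGraph V} (ρ : RotationSystem G)

theorem exists_dart_edge_eq (e : G.edgeSet) : ∃ d : G.Dart, d.edge = e := by
  obtain ⟨⟨u, v⟩, h⟩ := e
  exact ⟨⟨(u, v), h⟩, rfl⟩

/-- By definition `next d` is `faceNext d.symm`, so consecutive darts at a vertex bound a common
face. -/
theorem leftFace_next (d : G.Dart) : ρ.leftFace (ρ.next d) = ρ.leftFace d.symm := by
  refine Quotient.sound (Equiv.Perm.SameCycle.symm ⟨1, ?_⟩)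
  simp [faceNext]

theorem leftFace_surjective : Function.Surjective ρ.leftFace := Quot.mk_surjective

/-- Turning around a vertex from the dart `a` to the dart `b`: a function on the faces that does
not change across the darts strictly in between takes the same value at both ends. -/
theorem apply_leftFace_symm_eq [Finite V] {α : Type*} (c : ρ.Face → α) {a b : G.Dart}
    (hab : a.fst = b.fst)
    (h : ∀ e : G.Dart, e.fst = a.fst → e ≠ a → e ≠ b → c (ρ.leftFace e) = c (ρ.leftFace e.symm)) :
    c (ρ.leftFace a.symm) = c (ρ.leftFace b) := by
  classical
  have := Fintype.ofFinite V
  -- The exponent is positive so that `a = b` yields a full turn rather than an empty one.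
  have hex : ∃ i, 0 < i ∧ (ρ.next ^ i) a = b := by
    obtain ⟨i, hi, -, h⟩ := (ρ.sameCycle_of_fst_eq a b hab).exists_pow_eq''
    exact ⟨i, hi, h⟩
  have hfst : ∀ j, ((ρ.next ^ j) a).fst = a.fst := by
    intro j
    induction j with
    | zero => rfl
    | succ j ih => rw [pow_succ', Equiv.Perm.mul_apply, ρ.next_fst, ih]
  obtain ⟨hk0, hk⟩ := Nat.find_spec hex
  have hmin : ∀ i, 0 < i → i < Nat.find hex → (ρ.next ^ i) a ≠ b := fun i hi hlt he =>
    Nat.find_min hex hlt ⟨hi, he⟩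
  generalize Nat.find hex = k at *
  have key : ∀ j, j + 1 ≤ k → c (ρ.leftFace a.symm) = c (ρ.leftFace ((ρ.next ^ (j + 1)) a)) := by
    intro j
    induction j with
    | zero => intro _; rw [zero_add, pow_one, leftFace_next]
    | succ j ih =>
      intro hj
      rw [ih (by omega), pow_succ' _ (j + 1), Equiv.Perm.mul_apply, leftFace_next]
      refine h _ (hfst _) (fun ha => ?_) (hmin _ (by omega) (by omega))
      -- A return to `a` after `j + 1` steps would make `b` reachable in `k - (j + 1)` steps,
      -- against minimality.
      refine hmin (k - (j + 1)) (by omega) (by omega) ?_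
      rw [← hk]
      conv_rhs => rw [show k = (k - (j + 1)) + (j + 1) by omega, pow_add, Equiv.Perm.mul_apply, ha]
  obtain ⟨j, rfl⟩ : ∃ j, k = j + 1 := ⟨k - 1, by omega⟩
  rw [key j le_rfl, hk]

/-- The dual of a connected graph is connected. -/
theorem apply_eq_of_forall_leftFace_eq [Finite V] (hG : G.Connected) {α : Type*} (c : ρ.Face → α)
    (h : ∀ d : G.Dart, c (ρ.leftFace d) = c (ρ.leftFace d.symm)) (f g : ρ.Face) : c f = c g := by
  obtain ⟨a, rfl⟩ := ρ.leftFace_surjective f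
  obtain ⟨b, rfl⟩ := ρ.leftFace_surjective g
  have hrot : ∀ a b : G.Dart, a.fst = b.fst → c (ρ.leftFace a) = c (ρ.leftFace b) :=
    fun a b hab => (h a).trans (ρ.apply_leftFace_symm_eq c hab fun e _ _ _ => h e)
  have hwalk : ∀ {u v : V} (_ : G.Walk u v) (a b : G.Dart), a.fst = u → b.fst = v →
      c (ρ.leftFace a) = c (ρ.leftFace b) := by
    intro u v w
    induction w with
    | nil => exact fun a b ha hb => hrot a b (ha.trans hb.symm)
    | cons hadj p ih =>
      intro a b ha hb
      rw [hrot a ⟨(_, _), hadj⟩ ha, h]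
      exact ih _ _ rfl hb
  exact hwalk (hG.preconnected a.fst b.fst).some a b rfl rfl

end Rotation

/-! ### Cycles modulo 2 in a planar embedding bound -/

section Homology

variable {V : Type*} {G : SimpleGraph V} (ρ : RotationSystem G)

/-- The edges at which a 0-1 function on the faces jumps. -/
noncomputable def faceCoboundary : (ρ.Face → ZMod 2) →ₗ[ZMod 2] (G.edgeSet → ZMod 2) where
  toFun φ e := φ (ρ.leftFace (exists_dart_edge_eq e).choose) +
    φ (ρ.leftFace (exists_dart_edge_eq e).choose.symm)
  map_add' φ ψ := by ext e; simp only [Pi.add_apply]; ring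
  map_smul' a φ := by ext e; simp [mul_add]

theorem faceCoboundary_apply (φ : ρ.Face → ZMod 2) (d : G.Dart) :
    ρ.faceCoboundary φ ⟨d.edge, d.edge_mem⟩ = φ (ρ.leftFace d) + φ (ρ.leftFace d.symm) := by
  have h := (exists_dart_edge_eq ⟨d.edge, d.edge_mem⟩).choose_spec
  rw [SimpleGraph.dart_edge_eq_iff] at h
  simp only [faceCoboundary, LinearMap.coe_mk, AddHom.coe_mk]
  rcases h with h | h
  · rw [h]
  · rw [h, SimpleGraph.Dart.symm_symm, add_comm]

/-- The dual graph is connected, so the kernel contains only constants; then rank-nullity applies.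
-/
theorem card_face_le_finrank_range_faceCoboundary [Finite V] (hG : G.Connected)
    [Finite ρ.Face] :
    Nat.card ρ.Face ≤ Module.finrank (ZMod 2) (LinearMap.range ρ.faceCoboundary) + 1 := by
  classical
  have := Fintype.ofFinite ρ.Face
  have hker : LinearMap.ker ρ.faceCoboundary ≤ Submodule.span (ZMod 2) {fun _ => 1} := by
    intro φ hφ
    rw [LinearMap.mem_ker] at hφ
    have hc : ∀ d, φ (ρ.leftFace d) = φ (ρ.leftFace d.symm) := fun d => by
      rw [← CharTwo.add_eq_zero, ← faceCoboundary_apply, hφ, Pi.zero_apply]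
    rw [Submodule.mem_span_singleton]
    rcases isEmpty_or_nonempty ρ.Face with hE | ⟨⟨f⟩⟩
    · exact ⟨0, Subsingleton.elim _ _⟩
    · refine ⟨φ f, funext fun g => ?_⟩
      simpa using ρ.apply_eq_of_forall_leftFace_eq hG φ hc f g
  have h1 := Submodule.finrank_mono hker
  have h2 := finrank_span_le_card (R := ZMod 2) {(fun _ => 1 : ρ.Face → ZMod 2)}
  rw [Set.toFinset_singleton, Finset.card_singleton] at h2
  have h3 := LinearMap.finrank_range_add_finrank_ker ρ.faceCoboundary
  rw [Module.finrank_fintype_fun_eq_card] at h3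
  rw [Nat.card_eq_fintype_card]
  omega

variable [Fintype V] [DecidableEq V]

open scoped Classical in
/-- The boundary modulo 2 of a set of edges. -/
noncomputable def edgeBoundary (G : SimpleGraph V) :
    (G.edgeSet → ZMod 2) →ₗ[ZMod 2] (V → ZMod 2) where
  toFun z v := ∑ d : G.Dart with d.fst = v, z ⟨d.edge, d.edge_mem⟩
  map_add' z z' := by ext v; simp [Finset.sum_add_distrib]
  map_smul' a z := by ext v; simp [Finset.mul_sum]

/-- The edges of a walk, counted modulo 2. -/
def edgeCount {u v : V} (w : G.Walk u v) (e : G.edgeSet) : ZMod 2 := (w.edges.count (e : Sym2 V) : ℕ)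

/-- Each step contributes its two ends, and the intermediate vertices cancel modulo 2. A closed walk
thus has boundary zero. -/
theorem edgeBoundary_edgeCount {u v : V} (w : G.Walk u v) :
    edgeBoundary G (edgeCount w) = Pi.single u 1 + Pi.single v 1 := by
  classical
  induction w with
  | nil =>
    ext x
    simp [edgeBoundary, edgeCount, CharTwo.add_self_eq_zero]
  | @cons u v w hadj p ih =>
    have hsum : edgeCount (SimpleGraph.Walk.cons hadj p) =
        (fun e : G.edgeSet => if s(u, v) = (e : Sym2 V) then (1 : ZMod 2) else 0) + edgeCount p := by
      ext e
      simp only [edgeCount, SimpleGraph.Walk.edges_cons, List.count_cons, Pi.add_apply, beq_iff_eq]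
      push_cast
      rw [add_comm]
    have hedge : edgeBoundary G
        (fun e : G.edgeSet => if s(u, v) = (e : Sym2 V) then (1 : ZMod 2) else 0) =
        Pi.single u 1 + Pi.single v 1 := by
      ext x
      have hne : (⟨(u, v), hadj⟩ : G.Dart) ≠ ⟨(v, u), hadj.symm⟩ := by
        intro h
        exact hadj.ne (congrArg (fun d : G.Dart => d.fst) h)
      -- The indicator of an edge is the sum of the indicators of its two darts, which are distinct.
      have hd : ∀ d : G.Dart, (if s(u, v) = d.edge then (1 : ZMod 2) else 0) =
          (if d = ⟨(u, v), hadj⟩ then 1 else 0) + if d = ⟨(v, u), hadj.symm⟩ then 1 else 0 := by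
        intro d
        have : s(u, v) = d.edge ↔ d = ⟨(u, v), hadj⟩ ∨ d = ⟨(v, u), hadj.symm⟩ := by
          rw [eq_comm]
          exact SimpleGraph.dart_edge_eq_iff d ⟨(u, v), hadj⟩
        by_cases h1 : d = ⟨(u, v), hadj⟩
        · have h2 : d ≠ ⟨(v, u), hadj.symm⟩ := h1 ▸ hne
          simp [h1, hne]
        · simp [this, h1]
      simp only [edgeBoundary, LinearMap.coe_mk, AddHom.coe_mk, hd, Finset.sum_add_distrib,
        Finset.sum_ite_eq', Pi.add_apply, Finset.mem_filter, Finset.mem_univ, true_and,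
        Pi.single_apply, eq_comm]
    rw [hsum, map_add, hedge, ih, add_assoc, ← add_assoc (Pi.single v 1), ZModModule.add_self,
      zero_add]

/-- Walks to a base vertex `v₀` show that boundaries and the single vector at `v₀` span everything.
-/
theorem card_le_finrank_range_edgeBoundary (hG : G.Connected) :
    Nat.card V ≤ Module.finrank (ZMod 2) (LinearMap.range (edgeBoundary G)) + 1 := by
  obtain ⟨v₀⟩ := hG.nonempty
  have htop : LinearMap.range (edgeBoundary G) ⊔ Submodule.span (ZMod 2) {Pi.single v₀ 1} = ⊤ := by
    rw [eq_top_iff]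
    intro g _
    rw [← Finset.univ_sum_single g]
    refine Submodule.sum_mem _ fun v _ => ?_
    have : (Pi.single v (g v) : V → ZMod 2) =
        g v • ((Pi.single v 1 + Pi.single v₀ 1) + Pi.single v₀ 1) := by
      rw [add_assoc, ZModModule.add_self, add_zero, ← Pi.single_smul, smul_eq_mul, mul_one]
    rw [this, ← edgeBoundary_edgeCount (hG.preconnected v v₀).some]
    exact Submodule.smul_mem _ _ (Submodule.add_mem_sup ⟨_, rfl⟩ (Submodule.mem_span_singleton_self _))
  have h := Submodule.finrank_add_le_finrank_add_finrank (LinearMap.range (edgeBoundary G))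
    (Submodule.span (ZMod 2) {(Pi.single v₀ 1 : V → ZMod 2)})
  rw [htop, finrank_top, Module.finrank_fintype_fun_eq_card] at h
  have := finrank_span_le_card (R := ZMod 2) {(Pi.single v₀ 1 : V → ZMod 2)}
  rw [Set.toFinset_singleton, Finset.card_singleton] at this
  rw [Nat.card_eq_fintype_card]
  omega

/-- Reindexing by `next` at a vertex turns right faces into left faces, so each value is counted
twice. -/
theorem edgeBoundary_faceCoboundary (φ : ρ.Face → ZMod 2) :
    edgeBoundary G (ρ.faceCoboundary φ) = 0 := by
  classical
  ext v
  simp only [edgeBoundary, LinearMap.coe_mk, AddHom.coe_mk, faceCoboundary_apply,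
    Finset.sum_add_distrib, Pi.zero_apply]
  have : ∑ d : G.Dart with d.fst = v, φ (ρ.leftFace d.symm) =
      ∑ d : G.Dart with d.fst = v, φ (ρ.leftFace d) := by
    refine Finset.sum_equiv ρ.next (fun d => ?_) fun d _ => ?_
    · simp [ρ.next_fst]
    · rw [leftFace_next]
  rw [this, CharTwo.add_self_eq_zero]

/-- In a planar embedding, every set of edges without boundary modulo 2 separates the faces into
two sides. -/
theorem IsPlanar.exists_faceCoboundary_eq (hG : G.Connected) (hρ : ρ.IsPlanar)
    {z : G.edgeSet → ZMod 2} (hz : edgeBoundary G z = 0) : ∃ φ, ρ.faceCoboundary φ = z := by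
  classical
  have : Finite ρ.Face := Finite.of_surjective _ ρ.leftFace_surjective
  have hle : LinearMap.range ρ.faceCoboundary ≤ LinearMap.ker (edgeBoundary G) := by
    rintro _ ⟨φ, rfl⟩
    exact ρ.edgeBoundary_faceCoboundary φ
  have h1 := card_le_finrank_range_edgeBoundary hG
  have h2 := ρ.card_face_le_finrank_range_faceCoboundary hG
  have h3 := LinearMap.finrank_range_add_finrank_ker (edgeBoundary G)
  rw [Module.finrank_fintype_fun_eq_card, ← Nat.card_eq_fintype_card] at h3
  unfold IsPlanar at hρ
  -- With Euler's formula, the cycle space has dimension at most `|E| - |V| + 1 = |F| - 1`, which is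
  -- at most the dimension of the range.
  have heq := Submodule.eq_of_le_of_finrank_le hle (by omega)
  have : z ∈ LinearMap.range ρ.faceCoboundary := by rw [heq]; exact hz
  exact this

/-- In a planar embedding, two walks with the same ends together separate the faces into two
sides. -/
theorem IsPlanar.exists_add_eq_count_add_count (hG : G.Connected) (hρ : ρ.IsPlanar)
    {u v : V} (p q : G.Walk u v) : ∃ φ : ρ.Face → ZMod 2, ∀ d : G.Dart,
      φ (ρ.leftFace d) + φ (ρ.leftFace d.symm) =
        (p.edges.count d.edge : ℕ) + (q.edges.count d.edge : ℕ) := by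
  obtain ⟨φ, hφ⟩ := hρ.exists_faceCoboundary_eq ρ hG (z := edgeCount p + edgeCount q) (by
    rw [map_add, edgeBoundary_edgeCount, edgeBoundary_edgeCount, ZModModule.add_self])
  refine ⟨φ, fun d => ?_⟩
  rw [← faceCoboundary_apply, hφ]
  rfl

end Homology

/-! ### Combinatorics of laminar chords -/

section Chords

variable {V : Type*} {G : SimpleGraph V}

theorem mem_darts_iff_exists_getVert {u v : V} {w : G.Walk u v} {d : G.Dart} :
    d ∈ w.darts ↔ ∃ i < w.length, w.getVert i = d.fst ∧ w.getVert (i + 1) = d.snd := by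
  rw [List.mem_iff_getElem]
  constructor
  · rintro ⟨i, hi, rfl⟩
    refine ⟨i, by simpa using hi, ?_⟩
    rw [SimpleGraph.Walk.darts_getElem_eq_getVert]
    exact ⟨rfl, rfl⟩
  · rintro ⟨i, hi, h1, h2⟩
    refine ⟨i, by simpa using hi, ?_⟩
    rw [SimpleGraph.Walk.darts_getElem_eq_getVert]
    exact SimpleGraph.Dart.ext _ _ (Prod.ext h1 h2)

theorem edge_mem_edges_iff {u v : V} {w : G.Walk u v} {d : G.Dart} :
    d.edge ∈ w.edges ↔ d ∈ w.darts ∨ d.symm ∈ w.darts := by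
  constructor
  · intro h
    obtain ⟨e, he, hed⟩ := List.mem_map.1 h
    rcases (SimpleGraph.dart_edge_eq_iff e d).1 hed with rfl | rfl
    · exact Or.inl he
    · exact Or.inr he
  · rintro (h | h)
    · exact List.mem_map_of_mem h
    · rw [← d.edge_symm]
      exact List.mem_map_of_mem h

theorem fst_mem_support_of_edge_mem {u v : V} {w : G.Walk u v} {d : G.Dart} (h : d.edge ∈ w.edges) :
    d.fst ∈ w.support :=
  w.fst_mem_support_of_mem_edges h

theorem _root_.OrientedPath.ext_getVert {X Y : OrientedPath G} (hl : X.walk.length = Y.walk.length)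
    (h : ∀ i ≤ X.walk.length, X.walk.getVert i = Y.walk.getVert i) : X = Y := by
  obtain ⟨s, t, p, hp⟩ := X
  obtain ⟨s', t', q, hq⟩ := Y
  have hs : s = s' := by simpa using h 0 (Nat.zero_le _)
  have ht : t = t' := by
    have := h _ le_rfl
    simp only at this hl
    rw [p.getVert_length, hl, q.getVert_length] at this
    exact this
  subst hs ht
  obtain rfl : p = q := SimpleGraph.Walk.ext_getVert_le_length hl h
  rfl

variable {ρ : RotationSystem G} {r : V} {B : G.Walk r r} {𝒞 : Set (OrientedPath G)}
  {X Y : OrientedPath G}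

theorem IsChord.eq_zero_or_eq_length (hX : ρ.IsChord B X) {i : ℕ} (hi : i ≤ X.walk.length)
    (h : X.walk.getVert i ∈ B.support) : i = 0 ∨ i = X.walk.length := by
  rcases hX.interior _ (X.walk.getVert_mem_support i) h with h | h
  · exact Or.inl ((X.isPath.getVert_eq_start_iff hi).1 h)
  · exact Or.inr ((X.isPath.getVert_eq_end_iff hi).1 h)

theorem IsChord.getVert_length_mem (hX : ρ.IsChord B X) :
    X.walk.getVert X.walk.length ∈ B.support := by
  simpa using hX.target_mem

variable [DecidableEq V]

theorem _root_.SimpleGraph.Walk.IsPath.length_takeUntil_getVert {u v : V} {w : G.Walk u v}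
    (hw : w.IsPath) {i : ℕ} (hi : i ≤ w.length) (h : w.getVert i ∈ w.support) :
    (w.takeUntil (w.getVert i) h).length = i :=
  hw.getVert_injOn (w.length_takeUntil_le_length h) hi (SimpleGraph.Walk.getVert_length_takeUntil h)

/-- Two chords of a laminar set agree up to any common vertex off the boundary. -/
theorem IsLaminarChordSet.getVert_eq (h : ρ.IsLaminarChordSet B 𝒞) (hX : X ∈ 𝒞) (hY : Y ∈ 𝒞)
    {i : ℕ} (hi : i ≤ X.walk.length) (hB : X.walk.getVert i ∉ B.support)
    (hmem : X.walk.getVert i ∈ Y.walk.support) :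
    i < Y.walk.length ∧ ∀ j ≤ i, Y.walk.getVert j = X.walk.getVert j := by
  have hXi := X.walk.getVert_mem_support i
  have hs := h.laminar X hX Y hY _ hXi hmem hB
  have hl := X.isPath.length_takeUntil_getVert hi hXi
  have hl' : (Y.walk.takeUntil _ hmem).length = i := by
    have := congrArg List.length hs
    simp only [SimpleGraph.Walk.length_support] at this
    omega
  have hle : i ≤ Y.walk.length := hl' ▸ Y.walk.length_takeUntil_le_length hmem
  have heq : ∀ j ≤ i, Y.walk.getVert j = X.walk.getVert j := by
    intro j hj
    rw [← SimpleGraph.Walk.getVert_takeUntil hXi (hj.trans hl.ge),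
      ← SimpleGraph.Walk.getVert_takeUntil hmem (hj.trans hl'.ge)]
    refine Option.some_injective _ ?_
    rw [SimpleGraph.Walk.getVert_eq_support_getElem? _ (hj.trans hl.ge),
      SimpleGraph.Walk.getVert_eq_support_getElem? _ (hj.trans hl'.ge), hs]
  -- The inequality is strict because `Y` ends on the boundary, while the common vertex is off it.
  refine ⟨lt_of_le_of_ne hle fun hil => hB ?_, heq⟩
  rw [← heq i le_rfl, hil]
  exact (h.isChord Y hY).getVert_length_mem

/-- The last edge of a chord of a laminar set is on no other chord. -/
theorem IsLaminarChordSet.eq_of_snd_mem (h : ρ.IsLaminarChordSet B 𝒞) (hX : X ∈ 𝒞) (hY : Y ∈ 𝒞)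
    {d : G.Dart} (hdX : d ∈ X.walk.darts) (hdY : d ∈ Y.walk.darts) (hB : d.snd ∈ B.support) :
    X = Y := by
  obtain ⟨i, hi, hi1, hi2⟩ := mem_darts_iff_exists_getVert.1 hdX
  obtain ⟨j, hj, hj1, hj2⟩ := mem_darts_iff_exists_getVert.1 hdY
  have hlX : i + 1 = X.walk.length :=
    ((h.isChord X hX).eq_zero_or_eq_length hi (hi2 ▸ hB)).resolve_left (by omega)
  have hlY : j + 1 = Y.walk.length :=
    ((h.isChord Y hY).eq_zero_or_eq_length hj (hj2 ▸ hB)).resolve_left (by omega)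
  -- If the tail of `d` is on the boundary, `d` is the whole of both chords; otherwise laminarity at
  -- the tail applies.
  have key : i = j ∧ ∀ k ≤ i, Y.walk.getVert k = X.walk.getVert k := by
    by_cases hf : d.fst ∈ B.support
    · have hi0 : i = 0 := by
        have := (h.isChord X hX).eq_zero_or_eq_length hi.le (hi1 ▸ hf)
        omega
      have hj0 : j = 0 := by
        have := (h.isChord Y hY).eq_zero_or_eq_length hj.le (hj1 ▸ hf)
        omega
      subst hi0 hj0
      refine ⟨rfl, fun k hk => ?_⟩
      obtain rfl : k = 0 := by omega
      rw [hi1, hj1]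
    · have := h.getVert_eq hX hY hi.le (hi1 ▸ hf) (hi1 ▸ hj1 ▸ Y.walk.getVert_mem_support j)
      refine ⟨Y.isPath.getVert_injOn this.1.le hj.le ?_, this.2⟩
      rw [this.2 i le_rfl, hi1, hj1]
  obtain ⟨rfl, hk⟩ := key
  refine OrientedPath.ext_getVert (by omega) fun k hkl => ?_
  rcases Nat.lt_or_ge k (i + 1) with hlt | hge
  · exact (hk k (by omega)).symm
  · obtain rfl : k = i + 1 := by omega
    rw [hi2, hj2]

/-- A chord `Y` of a laminar set that meets a chord `X` in the `i`-th vertex of `X`, off the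
boundary: the edges of `Y` there are its `(i-1)`-st and its `i`-th edge. -/
theorem IsLaminarChordSet.edge_at (h : ρ.IsLaminarChordSet B 𝒞) (hX : X ∈ 𝒞) (hY : Y ∈ 𝒞)
    {i : ℕ} (hi : i ≤ X.walk.length) {e : G.Dart} (he : e.fst = X.walk.getVert i)
    (hB : X.walk.getVert i ∉ B.support) (heY : e.edge ∈ Y.walk.edges) :
    i < Y.walk.length ∧ (∀ j ≤ i, Y.walk.getVert j = X.walk.getVert j) ∧
      (Y.walk.getVert (i + 1) = e.snd ∨ 0 < i ∧ X.walk.getVert (i - 1) = e.snd) := by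
  obtain ⟨hl, heq⟩ := h.getVert_eq hX hY hi hB (he ▸ fst_mem_support_of_edge_mem heY)
  refine ⟨hl, heq, ?_⟩
  rcases edge_mem_edges_iff.1 heY with hd | hd
  · obtain ⟨j, hj, hj1, hj2⟩ := mem_darts_iff_exists_getVert.1 hd
    have : j = i := Y.isPath.getVert_injOn hj.le hl.le (by rw [hj1, he, heq i le_rfl])
    subst this
    exact Or.inl hj2
  · obtain ⟨j, hj, hj1, hj2⟩ := mem_darts_iff_exists_getVert.1 hd
    have : j + 1 = i := by
      refine Y.isPath.getVert_injOn (Nat.succ_le_of_lt hj) hl.le ?_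
      rw [hj2, heq i le_rfl, ← he]
      rfl
    subst this
    refine Or.inr ⟨Nat.succ_pos _, ?_⟩
    rw [Nat.add_sub_cancel, ← heq j (Nat.le_succ j), hj1]
    rfl

/-- Two chords of a laminar set run through an edge in opposite directions only if both consist of
this edge. -/
theorem IsLaminarChordSet.eq_of_symm_mem (h : ρ.IsLaminarChordSet B 𝒞) (hX : X ∈ 𝒞) (hY : Y ∈ 𝒞)
    {d : G.Dart} (hdX : d ∈ X.walk.darts) (hdY : d.symm ∈ Y.walk.darts) :
    ∀ e ∈ X.walk.darts, e = d := by
  -- Were the head of `d` off the boundary, `Y` would agree with `X` up to it and so run through `d`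
  -- forwards as well as backwards. By symmetry both ends of `d` are on the boundary.
  have hvert : ∀ {X Y : OrientedPath G}, X ∈ 𝒞 → Y ∈ 𝒞 → ∀ d : G.Dart, d ∈ X.walk.darts →
      d.symm ∈ Y.walk.darts → d.snd ∈ B.support := by
    intro X Y hX hY d hdX hdY
    by_contra hB
    obtain ⟨i, hi, hi1, hi2⟩ := mem_darts_iff_exists_getVert.1 hdX
    obtain ⟨j, hj, hj1, hj2⟩ := mem_darts_iff_exists_getVert.1 hdY
    change _ = d.snd at hj1
    change _ = d.fst at hj2
    obtain ⟨hl, heq⟩ := h.getVert_eq hX hY hi (hi2 ▸ hB)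
      (hi2 ▸ hj1 ▸ Y.walk.getVert_mem_support j)
    have h1 : j = i + 1 :=
      Y.isPath.getVert_injOn hj.le hl.le (by rw [hj1, heq (i + 1) le_rfl, hi2])
    have h2 : j + 1 = i := Y.isPath.getVert_injOn (Nat.succ_le_of_lt hj)
      (show i ≤ _ by omega) (by rw [hj2, heq i (Nat.le_succ i), hi1])
    omega
  have h2 := hvert hX hY d hdX hdY
  have h1 : d.fst ∈ B.support := hvert hY hX d.symm hdY (by simpa using hdX)
  obtain ⟨i, hi, hi1, hi2⟩ := mem_darts_iff_exists_getVert.1 hdX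
  have hi0 := (h.isChord X hX).eq_zero_or_eq_length hi.le (hi1 ▸ h1)
  have hl := (h.isChord X hX).eq_zero_or_eq_length hi (hi2 ▸ h2)
  intro e he
  obtain ⟨j, hj, hj1, hj2⟩ := mem_darts_iff_exists_getVert.1 he
  obtain rfl : j = i := by omega
  exact SimpleGraph.Dart.ext _ _ (Prod.ext (hj1.symm.trans hi1) (hj2.symm.trans hi2))

end Chords

/-! ### Faces on the left of the boundary cycle, and their pieces -/

section OutFaces

variable {V : Type*} {G : SimpleGraph V} {ρ : RotationSystem G}

theorem dualAvoiding_reachable {S : Set (Sym2 V)} {d : G.Dart} (hd : d.edge ∉ S) :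
    (ρ.dualAvoiding S).Reachable (ρ.leftFace d) (ρ.leftFace d.symm) := by
  by_cases h : ρ.leftFace d = ρ.leftFace d.symm
  · rw [h]
  · exact SimpleGraph.Adj.reachable ⟨h, d, hd, rfl, rfl⟩

theorem apply_eq_of_dualAvoiding_reachable {S : Set (Sym2 V)} {α : Type*} {c : ρ.Face → α}
    (hc : ∀ d : G.Dart, d.edge ∉ S → c (ρ.leftFace d) = c (ρ.leftFace d.symm)) {f g : ρ.Face}
    (h : (ρ.dualAvoiding S).Reachable f g) : c f = c g := by
  obtain ⟨w⟩ := h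
  induction w with
  | nil => rfl
  | cons hadj _ ih =>
    obtain ⟨-, d, hd, rfl, rfl⟩ := hadj
    exact (hc d hd).trans ih

variable {r : V} {B : G.Walk r r}

theorem isOutFace_leftFace_iff {d : G.Dart} (hd : d.edge ∉ B.edges) :
    ρ.IsOutFace B (ρ.leftFace d) ↔ ρ.IsOutFace B (ρ.leftFace d.symm) := by
  have h : (ρ.dualAvoiding {e | e ∈ B.edges}).Reachable (ρ.leftFace d) (ρ.leftFace d.symm) :=
    dualAvoiding_reachable hd
  exact ⟨fun ⟨b, hb, hr⟩ => ⟨b, hb, hr.trans h⟩, fun ⟨b, hb, hr⟩ => ⟨b, hb, hr.trans h.symm⟩⟩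

/-- At a vertex of the cycle, the turn from the reversed incoming edge to the outgoing edge crosses
no edge of `B`, so the left faces of consecutive edges are joined. -/
theorem reachable_leftFace_of_mem_darts [Finite V] (hB : B.IsCycle) {d d' : G.Dart}
    (hd : d ∈ B.darts) (hd' : d' ∈ B.darts) :
    (ρ.dualAvoiding {e | e ∈ B.edges}).Reachable (ρ.leftFace d) (ρ.leftFace d') := by
  have hl := hB.three_le_length
  have key : ∀ i, ∀ a b : G.Dart, i < B.length → B.getVert 0 = a.fst → B.getVert 1 = a.snd →
      B.getVert i = b.fst → B.getVert (i + 1) = b.snd →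
      (ρ.dualAvoiding {e | e ∈ B.edges}).Reachable (ρ.leftFace a) (ρ.leftFace b) := by
    intro i a
    induction i with
    | zero =>
      intro b _ h1 h2 h3 h4
      obtain rfl : a = b :=
        SimpleGraph.Dart.ext _ _ (Prod.ext (h1.symm.trans h3) (h2.symm.trans h4))
      rfl
    | succ i ih =>
      intro b hi h1 h2 h3 h4
      have hi' : i < B.length := by omega
      set m : G.Dart := ⟨(B.getVert i, B.getVert (i + 1)), B.adj_getVert_succ hi'⟩ with hm
      have hr := ih m hi' h1 h2 rfl rfl
      have := ρ.apply_leftFace_symm_eq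
        (fun f => (ρ.dualAvoiding {e | e ∈ B.edges}).Reachable (ρ.leftFace a) f)
        (a := m.symm) (b := b) h3 (fun e he hne hne' => ?_)
      · rw [SimpleGraph.Dart.symm_symm] at this
        exact this ▸ hr
      · have he' : e.edge ∉ B.edges := by
          intro hmem
          change e.fst = B.getVert (i + 1) at he
          rcases edge_mem_edges_iff.1 hmem with h | h
          · obtain ⟨j, hj, hj1, hj2⟩ := mem_darts_iff_exists_getVert.1 h
            -- Only the first and last positions of the cycle coincide, so tails are compared among
            -- `0, …, length - 1` and heads among `1, …, length`.
            have : j = i + 1 := hB.getVert_injOn' (show j ≤ _ by omega) (show i + 1 ≤ _ by omega)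
              (hj1.trans he)
            subst this
            exact hne' (SimpleGraph.Dart.ext _ _
              (Prod.ext (hj1.symm.trans h3) (hj2.symm.trans h4)))
          · obtain ⟨j, hj, hj1, hj2⟩ := mem_darts_iff_exists_getVert.1 h
            have : j + 1 = i + 1 := hB.getVert_injOn (show 1 ≤ j + 1 ∧ j + 1 ≤ _ by omega)
              (show 1 ≤ i + 1 ∧ i + 1 ≤ _ by omega) (hj2.trans he)
            obtain rfl : j = i := by omega
            exact hne (SimpleGraph.Dart.ext _ _ (Prod.ext he hj1.symm))
        have hr' : (ρ.dualAvoiding {e | e ∈ B.edges}).Reachable (ρ.leftFace e) (ρ.leftFace e.symm) :=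
          dualAvoiding_reachable he'
        exact propext ⟨fun h => h.trans hr', fun h => h.trans hr'.symm⟩
  obtain ⟨i, hi, hi1, hi2⟩ := mem_darts_iff_exists_getVert.1 hd
  obtain ⟨j, hj, hj1, hj2⟩ := mem_darts_iff_exists_getVert.1 hd'
  let a : G.Dart := ⟨(B.getVert 0, B.getVert (0 + 1)), B.adj_getVert_succ (by omega)⟩
  exact (key i a d hi rfl rfl hi1 hi2).symm.trans (key j a d' hj rfl rfl hj1 hj2)

theorem IsOutFace.reachable [Finite V] (hB : B.IsCycle) {f g : ρ.Face} (hf : ρ.IsOutFace B f)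
    (hg : ρ.IsOutFace B g) : (ρ.dualAvoiding {e | e ∈ B.edges}).Reachable f g := by
  obtain ⟨d, hd, hdf⟩ := hf
  obtain ⟨d', hd', hdg⟩ := hg
  exact hdf.symm.trans ((reachable_leftFace_of_mem_darts hB hd hd').trans hdg)

/-- In a planar embedding, a cycle has different faces on its two sides. -/
theorem IsPlanar.edge_notMem_of_isOutFace [Fintype V] [DecidableEq V] (hρ : ρ.IsPlanar)
    (hG : G.Connected) (hB : B.IsCycle) {d : G.Dart} (hl : ρ.IsOutFace B (ρ.leftFace d))
    (hr : ρ.IsOutFace B (ρ.leftFace d.symm)) : d.edge ∉ B.edges := by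
  intro hd
  -- Paired with the trivial walk, `B` yields a function that jumps exactly across `B`, hence is
  -- constant on the faces to its left.
  obtain ⟨φ, hφ⟩ := hρ.exists_add_eq_count_add_count ρ hG B .nil
  have hc := apply_eq_of_dualAvoiding_reachable (c := φ) (fun e he => ?_) (hl.reachable hB hr)
  · have := hφ d
    rw [hc, CharTwo.add_self_eq_zero, List.count_eq_one_of_mem hB.edges_nodup hd] at this
    simp at this
  · rw [← CharTwo.add_eq_zero, hφ, List.count_eq_zero_of_not_mem he]
    simp

variable {𝒞 : Set (OrientedPath G)}

theorem mem_cutEdges_iff_of_notMem {e : Sym2 V} (he : e ∉ B.edges) :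
    e ∈ cutEdges B 𝒞 ↔ ∃ X ∈ 𝒞, e ∈ X.walk.edges :=
  ⟨fun h => h.resolve_left he, Or.inr⟩

/-- The piece of a face on the left side of `B`. -/
def pieceOf (𝒞 : Set (OrientedPath G)) {f : ρ.Face} (hf : ρ.IsOutFace B f) : ρ.Piece B 𝒞 :=
  SimpleGraph.connectedComponentMk _ ⟨f, hf⟩

theorem exists_pieceOf_eq (P : ρ.Piece B 𝒞) :
    ∃ (f : ρ.Face) (hf : ρ.IsOutFace B f), pieceOf 𝒞 hf = P := by
  obtain ⟨⟨f, hf⟩, rfl⟩ := P.exists_rep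
  exact ⟨f, hf, rfl⟩

theorem pieceOf_leftFace_eq {d : G.Dart} (hd : d.edge ∉ cutEdges B 𝒞)
    (hl : ρ.IsOutFace B (ρ.leftFace d)) (hr : ρ.IsOutFace B (ρ.leftFace d.symm)) :
    pieceOf 𝒞 hl = pieceOf 𝒞 hr := by
  refine SimpleGraph.ConnectedComponent.sound ?_
  by_cases h : ρ.leftFace d = ρ.leftFace d.symm
  · simp only [h]
    rfl
  · exact SimpleGraph.Adj.reachable (SimpleGraph.comap_adj.2 ⟨h, d, hd, rfl, rfl⟩)

/-- A function on the faces that changes only across the boundary and the chords is constant on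
each piece. -/
theorem apply_eq_of_pieceOf_eq {α : Type*} {c : ρ.Face → α}
    (hc : ∀ d : G.Dart, d.edge ∉ cutEdges B 𝒞 → c (ρ.leftFace d) = c (ρ.leftFace d.symm))
    {f g : ρ.Face} {hf : ρ.IsOutFace B f} {hg : ρ.IsOutFace B g}
    (h : pieceOf 𝒞 hf = pieceOf 𝒞 hg) : c f = c g :=
  apply_eq_of_dualAvoiding_reachable hc
    ((SimpleGraph.ConnectedComponent.exact h).map (SimpleGraph.Embedding.induce _).toHom)

theorem pieceGraph_adj_of_unique {d : G.Dart} (hl : ρ.IsOutFace B (ρ.leftFace d))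
    (hr : ρ.IsOutFace B (ρ.leftFace d.symm)) {X : OrientedPath G} (hX : X ∈ 𝒞)
    (hd : d ∈ X.walk.darts) (hu : ∀ Y ∈ 𝒞, d ∈ Y.walk.darts → Y = X)
    (hne : pieceOf 𝒞 hl ≠ pieceOf 𝒞 hr) :
    (ρ.pieceGraph B 𝒞).Adj (pieceOf 𝒞 hl) (pieceOf 𝒞 hr) :=
  ⟨hne, d, ⟨⟨_, hl⟩, rfl, Or.inl rfl⟩, ⟨⟨_, hr⟩, rfl, Or.inr rfl⟩, X, ⟨hX, hd⟩,
    fun Y hY => hu Y hY.1 hY.2⟩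

theorem exists_dart_of_pieceGraph_adj {P Q : ρ.Piece B 𝒞} (h : (ρ.pieceGraph B 𝒞).Adj P Q) :
    ∃ (d : G.Dart) (hl : ρ.IsOutFace B (ρ.leftFace d)) (hr : ρ.IsOutFace B (ρ.leftFace d.symm)),
      s(pieceOf 𝒞 hl, pieceOf 𝒞 hr) = s(P, Q) ∧
        ∃ X ∈ 𝒞, d ∈ X.walk.darts ∧ ∀ Y ∈ 𝒞, d ∈ Y.walk.darts → Y = X := by
  obtain ⟨hne, d, ⟨⟨f, hf⟩, rfl, hfd⟩, ⟨⟨g, hg⟩, rfl, hgd⟩, X, ⟨hX, hd⟩, hu⟩ := h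
  dsimp only at hfd hgd
  have hex : ∃ X ∈ 𝒞, d ∈ X.walk.darts ∧ ∀ Y ∈ 𝒞, d ∈ Y.walk.darts → Y = X :=
    ⟨X, hX, hd, fun Y hY hdY => hu Y ⟨hY, hdY⟩⟩
  rcases hfd with rfl | rfl <;> rcases hgd with rfl | rfl
  · exact absurd rfl hne
  · exact ⟨d, hf, hg, rfl, hex⟩
  · exact ⟨d, hg, hf, Sym2.eq_swap, hex⟩
  · exact absurd rfl hne

end OutFaces

/-! ### The piece graph is connected and acyclic -/

section PieceTree

variable {V : Type*} [Fintype V] [DecidableEq V] {G : SimpleGraph V} {ρ : RotationSystem G} {r : V}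
  {B : G.Walk r r} {𝒞 : Set (OrientedPath G)}

/-- The two sides of an edge of a chord lie in pieces that are joined in the piece graph. -/
theorem IsLaminarChordSet.reachable_iff_of_getVert (h : ρ.IsLaminarChordSet B 𝒞)
    (P : ρ.Piece B 𝒞) (n : ℕ) :
    ∀ X ∈ 𝒞, ∀ (i : ℕ) (d : G.Dart), i < X.walk.length → Fintype.card V ≤ i + n →
      X.walk.getVert i = d.fst → X.walk.getVert (i + 1) = d.snd → d.edge ∉ B.edges →
      ((∃ hf : ρ.IsOutFace B (ρ.leftFace d), (ρ.pieceGraph B 𝒞).Reachable P (pieceOf 𝒞 hf)) ↔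
        ∃ hf : ρ.IsOutFace B (ρ.leftFace d.symm),
          (ρ.pieceGraph B 𝒞).Reachable P (pieceOf 𝒞 hf)) := by
  -- The number `n` bounds the remaining length of the chord; a path has fewer than `card V` edges,
  -- so `n = 0` is vacuous.
  induction n with
  | zero =>
    intro X _ i d hi hn
    have := X.isPath.length_lt
    omega
  | succ n ih =>
    intro X hX i d hi hn h1 h2 hdB
    by_cases hB : d.snd ∈ B.support
    · have hd : d ∈ X.walk.darts := mem_darts_iff_exists_getVert.2 ⟨i, hi, h1, h2⟩
      have hout := isOutFace_leftFace_iff (ρ := ρ) hdB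
      have hreach : ∀ (hl : ρ.IsOutFace B (ρ.leftFace d)) (hr : ρ.IsOutFace B (ρ.leftFace d.symm)),
          (ρ.pieceGraph B 𝒞).Reachable (pieceOf 𝒞 hl) (pieceOf 𝒞 hr) := by
        intro hl hr
        by_cases hne : pieceOf 𝒞 hl = pieceOf 𝒞 hr
        · rw [hne]
        · exact (pieceGraph_adj_of_unique hl hr hX hd
            (fun Y hY hdY => h.eq_of_snd_mem hY hX hdY hd hB) hne).reachable
      exact ⟨fun ⟨hf, hr⟩ => ⟨hout.1 hf, hr.trans (hreach hf _)⟩,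
        fun ⟨hf, hr⟩ => ⟨hout.2 hf, hr.trans (hreach _ hf).symm⟩⟩
    -- A full turn around the head of `d`, starting and ending at `d.symm`, leads from one side of
    -- `d` to the other.
    · have := ρ.apply_leftFace_symm_eq
        (fun f => ∃ hf : ρ.IsOutFace B f, (ρ.pieceGraph B 𝒞).Reachable P (pieceOf 𝒞 hf))
        (a := d.symm) (b := d.symm) rfl (fun e he hne _ => ?_)
      · rw [SimpleGraph.Dart.symm_symm] at this
        exact Iff.of_eq this
      · have he' : e.fst = X.walk.getVert (i + 1) := by rw [h2, he]; rfl
        have heB : e.edge ∉ B.edges := fun hmem => hB (by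
          rw [← h2, ← he']
          exact fst_mem_support_of_edge_mem hmem)
        by_cases hcut : e.edge ∈ cutEdges B 𝒞
        -- By laminarity `e` is either edge number `i + 1` of `Y`, where the induction hypothesis
        -- applies, or `d.symm`, which is excluded.
        · obtain ⟨Y, hY, heY⟩ := (mem_cutEdges_iff_of_notMem heB).1 hcut
          obtain ⟨hl, heq, hor⟩ := h.edge_at hX hY hi he' (h2 ▸ hB) heY
          rcases hor with hor | ⟨-, hor⟩
          · exact propext (ih Y hY (i + 1) e hl (by omega) ((heq _ le_rfl).trans he'.symm) hor heB)
          · exact absurd (SimpleGraph.Dart.ext _ _ (Prod.ext he (hor.symm.trans h1))) hne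
        · have hout := isOutFace_leftFace_iff (ρ := ρ) heB
          exact propext ⟨fun ⟨hf, hr⟩ => ⟨hout.1 hf, pieceOf_leftFace_eq hcut hf (hout.1 hf) ▸ hr⟩,
            fun ⟨hf, hr⟩ => ⟨hout.2 hf, (pieceOf_leftFace_eq hcut (hout.2 hf) hf).symm ▸ hr⟩⟩

/-- Reachability from a fixed piece, as a property of faces, survives crossing any edge off `B`, and
such crossings join all faces on the left of `B`. -/
theorem IsLaminarChordSet.pieceGraph_connected (h : ρ.IsLaminarChordSet B 𝒞) (hB : B.IsCycle) :
    (ρ.pieceGraph B 𝒞).Connected := by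
  have hpre : (ρ.pieceGraph B 𝒞).Preconnected := by
    intro P Q
    obtain ⟨f, hf, hfP⟩ := exists_pieceOf_eq P
    obtain ⟨g, hg, rfl⟩ := exists_pieceOf_eq Q
    have hc := apply_eq_of_dualAvoiding_reachable
      (c := fun f => ∃ hf : ρ.IsOutFace B f, (ρ.pieceGraph B 𝒞).Reachable P (pieceOf 𝒞 hf))
      (fun d hd => ?_) (hf.reachable hB hg)
    · obtain ⟨_, hr⟩ := (Iff.of_eq hc).1 ⟨hf, hfP ▸ .rfl⟩
      exact hr
    · have hdB : d.edge ∉ B.edges := hd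
      by_cases hcut : d.edge ∈ cutEdges B 𝒞
      · obtain ⟨X, hX, hdX⟩ := (mem_cutEdges_iff_of_notMem hdB).1 hcut
        rcases edge_mem_edges_iff.1 hdX with hd | hd
        · obtain ⟨i, hi, hi1, hi2⟩ := mem_darts_iff_exists_getVert.1 hd
          exact propext (h.reachable_iff_of_getVert P _ X hX i d hi (Nat.le_add_left _ _) hi1 hi2 hdB)
        · obtain ⟨i, hi, hi1, hi2⟩ := mem_darts_iff_exists_getVert.1 hd
          have := h.reachable_iff_of_getVert P _ X hX i d.symm hi (Nat.le_add_left _ _) hi1 hi2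
            (by rwa [d.edge_symm])
          rw [SimpleGraph.Dart.symm_symm] at this
          exact propext this.symm
      · have hout := isOutFace_leftFace_iff (ρ := ρ) hdB
        exact propext ⟨fun ⟨hf, hr⟩ => ⟨hout.1 hf, pieceOf_leftFace_eq hcut hf (hout.1 hf) ▸ hr⟩,
          fun ⟨hf, hr⟩ => ⟨hout.2 hf, (pieceOf_leftFace_eq hcut (hout.2 hf) hf).symm ▸ hr⟩⟩
  have hl := hB.three_le_length
  have hd : (⟨(_, _), B.adj_getVert_succ (show 0 < B.length by omega)⟩ : G.Dart) ∈ B.darts :=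
    mem_darts_iff_exists_getVert.2 ⟨0, by omega, rfl, rfl⟩
  have : Nonempty (ρ.Piece B 𝒞) := ⟨pieceOf 𝒞 ⟨_, hd, .rfl⟩⟩
  exact ⟨hpre⟩

/-- Going along a chord from an edge that is on no other chord: the following edges are on no other
chord, and on either side the chord stays next to the same piece. -/
theorem IsLaminarChordSet.sides_eq (h : ρ.IsLaminarChordSet B 𝒞) {X : OrientedPath G} (hX : X ∈ 𝒞)
    {α : Type*} {c : ρ.Face → α}
    (hc : ∀ d : G.Dart, d.edge ∉ cutEdges B 𝒞 → c (ρ.leftFace d) = c (ρ.leftFace d.symm))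
    {i : ℕ} {d : G.Dart} (hi1 : X.walk.getVert i = d.fst) (hi2 : X.walk.getVert (i + 1) = d.snd)
    (hu : ∀ Y ∈ 𝒞, d ∈ Y.walk.darts → Y = X) (k : ℕ) :
    ∀ d' : G.Dart, i + k < X.walk.length → X.walk.getVert (i + k) = d'.fst →
      X.walk.getVert (i + k + 1) = d'.snd →
      (∀ Y ∈ 𝒞, d' ∈ Y.walk.darts → Y = X) ∧ c (ρ.leftFace d) = c (ρ.leftFace d') ∧
        c (ρ.leftFace d.symm) = c (ρ.leftFace d'.symm) := by
  induction k with
  | zero =>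
    intro d' _ h1 h2
    obtain rfl : d = d' :=
      SimpleGraph.Dart.ext _ _ (Prod.ext (hi1.symm.trans h1) (hi2.symm.trans h2))
    exact ⟨hu, rfl, rfl⟩
  | succ k ih =>
    intro d' hlt h1 h2
    have hlt' : i + k < X.walk.length := by omega
    set m : G.Dart := ⟨(X.walk.getVert (i + k), X.walk.getVert (i + k + 1)),
      X.walk.adj_getVert_succ hlt'⟩ with hm
    obtain ⟨hum, hl, hr⟩ := ih m hlt' rfl rfl
    have hB : X.walk.getVert (i + k + 1) ∉ B.support := fun hmem => by
      have := (h.isChord X hX).eq_zero_or_eq_length hlt' hmem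
      omega
    -- A chord with an edge at this vertex agrees with `X` up to it, hence contains `m`; as `m` is
    -- private to `X`, the chord is `X`.
    have hY : ∀ Y ∈ 𝒞, ∀ e : G.Dart, e.fst = X.walk.getVert (i + k + 1) → e.edge ∈ Y.walk.edges →
        Y = X ∧ (e = d' ∨ e = m.symm) := by
      intro Y hY e he heY
      obtain ⟨hlY, heq, hor⟩ := h.edge_at hX hY hlt' he hB heY
      obtain rfl : Y = X := hum Y hY (mem_darts_iff_exists_getVert.2
        ⟨i + k, by omega, heq _ (Nat.le_succ _), heq _ le_rfl⟩)
      refine ⟨rfl, ?_⟩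
      rcases hor with hor | ⟨-, hor⟩
      · exact Or.inl (SimpleGraph.Dart.ext _ _ (Prod.ext (he.trans h1) (hor.symm.trans h2)))
      · exact Or.inr (SimpleGraph.Dart.ext _ _ (Prod.ext he hor.symm))
    have hcut : ∀ e : G.Dart, e.fst = X.walk.getVert (i + k + 1) → e ≠ m.symm → e ≠ d' →
        c (ρ.leftFace e) = c (ρ.leftFace e.symm) := by
      refine fun e he hne hne' => hc e ?_
      rintro (hmem | ⟨Y, hYC, heY⟩)
      · exact hB (he ▸ fst_mem_support_of_edge_mem hmem)
      · rcases (hY Y hYC e he heY).2 with h | h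
        · exact hne' h
        · exact hne h
    refine ⟨fun Y hYC hd' => (hY Y hYC d' h1.symm (List.mem_map_of_mem hd')).1, hl.trans ?_,
      hr.trans ?_⟩
    -- The two arcs of the rotation between `m.symm` and `d'` give the left and the right side.
    · have := ρ.apply_leftFace_symm_eq c (a := m.symm) (b := d') h1 (fun e he => hcut e he)
      rwa [SimpleGraph.Dart.symm_symm] at this
    · exact (ρ.apply_leftFace_symm_eq c (a := d') (b := m.symm) h1.symm
        (fun e he hne hne' => hcut e (he.trans h1.symm) hne' hne)).symm

/-- All edges that a chord shares with no other chord have the same piece on either side. -/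
theorem IsLaminarChordSet.pieceOf_eq_of_unique (h : ρ.IsLaminarChordSet B 𝒞) {X : OrientedPath G}
    (hX : X ∈ 𝒞) {d d' : G.Dart} (hd : d ∈ X.walk.darts) (hd' : d' ∈ X.walk.darts)
    (hu : ∀ Y ∈ 𝒞, d ∈ Y.walk.darts → Y = X) (hu' : ∀ Y ∈ 𝒞, d' ∈ Y.walk.darts → Y = X)
    (hl : ρ.IsOutFace B (ρ.leftFace d)) (hr : ρ.IsOutFace B (ρ.leftFace d.symm))
    (hl' : ρ.IsOutFace B (ρ.leftFace d')) (hr' : ρ.IsOutFace B (ρ.leftFace d'.symm)) :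
    pieceOf 𝒞 hl = pieceOf 𝒞 hl' ∧ pieceOf 𝒞 hr = pieceOf 𝒞 hr' := by
  -- Pieces are defined only for faces on the left of `B`; membership in a fixed piece is a function
  -- on all faces.
  have hc : ∀ P : ρ.Piece B 𝒞, ∀ d : G.Dart, d.edge ∉ cutEdges B 𝒞 →
      (∃ hf : ρ.IsOutFace B (ρ.leftFace d), pieceOf 𝒞 hf = P) =
        ∃ hf : ρ.IsOutFace B (ρ.leftFace d.symm), pieceOf 𝒞 hf = P := by
    intro P d hd
    have hout := isOutFace_leftFace_iff (ρ := ρ) (B := B) (d := d) fun hmem => hd (Or.inl hmem)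
    exact propext ⟨fun ⟨hf, hp⟩ => ⟨hout.1 hf, (pieceOf_leftFace_eq hd hf (hout.1 hf)).symm.trans hp⟩,
      fun ⟨hf, hp⟩ => ⟨hout.2 hf, (pieceOf_leftFace_eq hd (hout.2 hf) hf).trans hp⟩⟩
  obtain ⟨i, hi, hi1, hi2⟩ := mem_darts_iff_exists_getVert.1 hd
  obtain ⟨j, hj, hj1, hj2⟩ := mem_darts_iff_exists_getVert.1 hd'
  rcases Nat.le_total i j with hij | hij
  · obtain ⟨k, rfl⟩ := Nat.exists_eq_add_of_le hij
    have hs := fun P => (h.sides_eq hX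
      (c := fun f => ∃ hf : ρ.IsOutFace B f, pieceOf 𝒞 hf = P) (hc P) hi1 hi2 hu k d' hj hj1 hj2).2
    obtain ⟨_, h1⟩ := (Iff.of_eq (hs (pieceOf 𝒞 hl)).1).1 ⟨hl, rfl⟩
    obtain ⟨_, h2⟩ := (Iff.of_eq (hs (pieceOf 𝒞 hr)).2).1 ⟨hr, rfl⟩
    exact ⟨h1.symm, h2.symm⟩
  · obtain ⟨k, rfl⟩ := Nat.exists_eq_add_of_le hij
    have hs := fun P => (h.sides_eq hX
      (c := fun f => ∃ hf : ρ.IsOutFace B f, pieceOf 𝒞 hf = P) (hc P) hj1 hj2 hu' k d hi hi1 hi2).2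
    obtain ⟨_, h1⟩ := (Iff.of_eq (hs (pieceOf 𝒞 hl')).1).1 ⟨hl', rfl⟩
    obtain ⟨_, h2⟩ := (Iff.of_eq (hs (pieceOf 𝒞 hr')).2).1 ⟨hr', rfl⟩
    exact ⟨h1, h2⟩

/-- A chord separates the faces on the left side of `B` into two sides. -/
theorem IsChord.exists_sides (hG : G.Connected) (hρ : ρ.IsPlanar) {X : OrientedPath G}
    (hX : ρ.IsChord B X) : ∃ φ : ρ.Face → ZMod 2, ∀ d : G.Dart, d.edge ∉ B.edges →
      φ (ρ.leftFace d) + φ (ρ.leftFace d.symm) = if d.edge ∈ X.walk.edges then 1 else 0 := by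
  -- The chord is closed up inside `B`, through the base point `r`; repeated edges are harmless,
  -- since only edges off `B` are examined.
  let q : G.Walk X.source X.target :=
    (B.takeUntil _ hX.source_mem).reverse.append (B.takeUntil _ hX.target_mem)
  obtain ⟨φ, hφ⟩ := hρ.exists_add_eq_count_add_count ρ hG X.walk q
  refine ⟨φ, fun d hd => ?_⟩
  have hq : d.edge ∉ q.edges := by
    intro hmem
    rw [SimpleGraph.Walk.edges_append, SimpleGraph.Walk.edges_reverse, List.mem_append,
      List.mem_reverse] at hmem
    exact hd (hmem.elim (fun h => B.edges_takeUntil_subset_edges _ h)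
      fun h => B.edges_takeUntil_subset_edges _ h)
  rw [hφ, List.count_eq_zero_of_not_mem hq]
  split_ifs with h
  · rw [List.count_eq_one_of_mem X.isPath.isTrail.edges_nodup h]
    simp
  · rw [List.count_eq_zero_of_not_mem h]
    simp

/-- Each adjacency is a bridge: the side function of a chord that witnesses it changes along this
adjacency and along no other. -/
theorem IsLaminarChordSet.pieceGraph_isAcyclic (hG : G.Connected) (hρ : ρ.IsPlanar)
    (hB : B.IsCycle) (h : ρ.IsLaminarChordSet B 𝒞) : (ρ.pieceGraph B 𝒞).IsAcyclic := by
  rw [SimpleGraph.isAcyclic_iff_forall_isBridge]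
  refine fun s hs => ?_
  induction s with | _ P Q
  obtain ⟨d, hl, hr, hs, X, hX, hd, hu⟩ := exists_dart_of_pieceGraph_adj hs
  rw [← hs, SimpleGraph.isBridge_iff]
  intro hreach
  have hdB := hρ.edge_notMem_of_isOutFace hG hB hl hr
  obtain ⟨φ, hφ⟩ := (h.isChord X hX).exists_sides hG hρ
  have hc : ∀ e : G.Dart, e.edge ∉ cutEdges B 𝒞 → φ (ρ.leftFace e) = φ (ρ.leftFace e.symm) := by
    intro e he
    rw [← CharTwo.add_eq_zero, hφ e fun hmem => he (Or.inl hmem),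
      if_neg fun hmem => he (Or.inr ⟨X, hX, hmem⟩)]
  -- Representative faces let `φ` descend to the pieces.
  choose face hface hpiece using exists_pieceOf_eq (ρ := ρ) (B := B) (𝒞 := 𝒞)
  have hΦ : ∀ {f : ρ.Face} (hf : ρ.IsOutFace B f), φ (face (pieceOf 𝒞 hf)) = φ f :=
    fun hf => apply_eq_of_pieceOf_eq hc (hpiece (pieceOf 𝒞 hf))
  have hadj : ∀ P' Q', ((ρ.pieceGraph B 𝒞).deleteEdges {s(pieceOf 𝒞 hl, pieceOf 𝒞 hr)}).Adj P' Q' →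
      φ (face P') = φ (face Q') := by
    intro P' Q' hPQ
    rw [SimpleGraph.deleteEdges_adj, Set.mem_singleton_iff] at hPQ
    obtain ⟨hPQ, hne⟩ := hPQ
    obtain ⟨d', hl', hr', hs', X', hX', hd', hu'⟩ := exists_dart_of_pieceGraph_adj hPQ
    have hd'B := hρ.edge_notMem_of_isOutFace hG hB hl' hr'
    have hd'X : d'.edge ∉ X.walk.edges := by
      intro hmem
      -- A witness `d'` on `X` gives back the deleted pair: in the direction of `X` it has the same
      -- pieces beside it as `d`, and in the opposite direction it is `d.symm`.
      refine hne (hs'.symm.trans ?_)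
      rcases edge_mem_edges_iff.1 hmem with hm | hm
      · obtain rfl : X = X' := hu' X hX hm
        obtain ⟨h1, h2⟩ := h.pieceOf_eq_of_unique hX hd hd' hu hu' hl hr hl' hr'
        rw [h1, h2]
      · obtain rfl : d = d'.symm := h.eq_of_symm_mem hX hX' hm (by simpa using hd') d hd
        simp only [SimpleGraph.Dart.symm_symm]
        exact Sym2.eq_swap
    have hφ' : φ (ρ.leftFace d') = φ (ρ.leftFace d'.symm) := by
      rw [← CharTwo.add_eq_zero, hφ d' hd'B, if_neg hd'X]
    rcases Sym2.eq_iff.1 hs' with ⟨rfl, rfl⟩ | ⟨rfl, rfl⟩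
    · rw [hΦ, hΦ, hφ']
    · rw [hΦ, hΦ, hφ']
  have hconst : ∀ {P' Q'}, ((ρ.pieceGraph B 𝒞).deleteEdges
      {s(pieceOf 𝒞 hl, pieceOf 𝒞 hr)}).Walk P' Q' → φ (face P') = φ (face Q') := by
    intro P' Q' w
    induction w with
    | nil => rfl
    | cons ha _ ih => exact (hadj _ _ ha).trans ih
  have h1 := hφ d hdB
  rw [if_pos (edge_mem_edges_iff.2 (Or.inl hd)), ← hΦ hl, ← hΦ hr, hconst hreach.some,
    CharTwo.add_self_eq_zero] at h1
  exact zero_ne_one h1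

end PieceTree
end RotationSystem

theorem lemma4p4 {V : Type*} [Fintype V] [DecidableEq V] (G : SimpleGraph V) (hG : G.Connected)
    (ρ : RotationSystem G) (hρ : ρ.IsPlanar)
    {r : V} (B : G.Walk r r) (hB : B.IsCycle)
    (𝒞 : Set (OrientedPath G)) (h𝒞 : ρ.IsLaminarChordSet B 𝒞) :
    (ρ.pieceGraph B 𝒞).IsTree :=
  ⟨h𝒞.pieceGraph_connected hB, h𝒞.pieceGraph_isAcyclic hG hρ hB⟩
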